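/- Let $(n_k)_{k\ge 1}$ be a sequence of positive integers satisfying the Hadamard gap condition $n_{k+1}/n_k\ge q$ for all $k\ge 1$, for some constant $q>1$. Let $(\lambda_N)_{N\ge 1}$ be a sequence of positive real numbers with $\lambda_N\to 0$ and $\sqrt N\,\lambda_N\to\infty$ as $N\to\infty$. Let $\mathbb P$ be Lebesgue measure on $(0,1)$ and put $$X_N(x)=\frac{\lambda_N}{\sqrt N}\sum_{k=1}^N\sqrt2\cos(2\pi n_k x),\qquad x\in(0,1).$$ Then $(X_N)_{N\ge1}$ satisfies a moderate deviation principle at speed $1/\lambda_N^2$ with variance $\sigma^2=1$; that is, for every Borel set $B\subseteq\mathbb R$, with interior $B^\circ$ and closure $\overline B$, $$-\inf_{x\in B^\circ}\frac{x^2}{2}\le\liminf_{N\to\infty}\lambda_N^2\log\mathbb P(X_N\in B)\le\limsup_{N\to\infty}\lambda_N^2\log\mathbb P(X_N\in B)\le-\inf_{x\in\overline B}\frac{x^2}{2},$$ where $\log 0=-\infty$ and $\inf\emptyset=+\infty$. -/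

import Mathlib

open Filter Topology MeasureTheory

noncomputable section

/-- Lebesgue measure on the open unit interval `(0,1)`, as a (probability) measure on `ℝ`. -/
def unitIntervalMeasure : Measure ℝ := (volume : Measure ℝ).restrict (Set.Ioo 0 1)

/-- A sequence of positive integers `n 1, n 2, …` satisfies the Hadamard gap condition with
constant `q` (the value `n 0` plays no role). -/
def HadamardGap (n : ℕ → ℕ) (q : ℝ) : Prop :=
  1 < q ∧ (∀ k, 1 ≤ k → 0 < n k) ∧ ∀ k, 1 ≤ k → q ≤ (n (k + 1) : ℝ) / (n k : ℝ)

/-- The normalized lacunary sum `(lam N / √N) * ∑_{k=1}^N √2 cos(2π n_k x)`. -/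
def lacunarySum (n : ℕ → ℕ) (lam : ℕ → ℝ) (N : ℕ) (x : ℝ) : ℝ :=
  lam N / √(N : ℝ) * ∑ k ∈ Finset.Icc 1 N, √2 * Real.cos (2 * Real.pi * (n k : ℝ) * x)

/-- The random variables `X N` on `(Ω, P)` satisfy a moderate deviation principle at speed
`1 / (lam N)^2` with variance `σ2 > 0`, i.e. with rate function `x ^ 2 / (2 * σ2)`.
All terms are extended reals: `log 0 = -∞`, and the infimum over the empty set is `+∞`. -/
def SatisfiesMDP {Ω : Type*} [MeasurableSpace Ω] (P : Measure Ω) (X : ℕ → Ω → ℝ)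
    (lam : ℕ → ℝ) (σ2 : ℝ) : Prop :=
  0 < σ2 ∧ (∀ N, Measurable (X N)) ∧
  ∀ B : Set ℝ, MeasurableSet B →
    (-(⨅ x ∈ interior B, ((x ^ 2 / (2 * σ2) : ℝ) : EReal)) ≤
      liminf (fun N : ℕ => ((lam N ^ 2 : ℝ) : EReal) * ENNReal.log (P (X N ⁻¹' B))) atTop) ∧
    (liminf (fun N : ℕ => ((lam N ^ 2 : ℝ) : EReal) * ENNReal.log (P (X N ⁻¹' B))) atTop ≤
      limsup (fun N : ℕ => ((lam N ^ 2 : ℝ) : EReal) * ENNReal.log (P (X N ⁻¹' B))) atTop) ∧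
    (limsup (fun N : ℕ => ((lam N ^ 2 : ℝ) : EReal) * ENNReal.log (P (X N ⁻¹' B))) atTop ≤
      -(⨅ x ∈ closure B, ((x ^ 2 / (2 * σ2) : ℝ) : EReal)))

end

open ProbabilityTheory

/-! By Gärtner–Ellis (`satisfiesMDP_one_of_tendsto_cgf`) it is enough that `lam N ^ 2` times the
cumulant generating function of `X N` at `θ / lam N ^ 2` tends to `θ ^ 2 / 2`. The upper bound is
then Chernoff's; the lower bound is exponential tilting, with the tilted mass outside a ball
estimated by neighbouring exponential moments.

For the cumulants, the sum is cut into long blocks of length `L` separated by short ones of length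
`G`, both fixed as `N` grows. On each block `exp y` is replaced by `1 + y + y ^ 2 / 2`. By the gap
condition such a factor is its mean plus a cosine polynomial whose frequencies dominate those of all
earlier factors, so the integral of the product is exactly the product of the means
(`exists_gap_forall_integral_prod_eq`). The Taylor errors are cubic in `1 / (√N * lam N)` per block
and vanish in the limit because `√N * lam N → ∞`.

Hölder's inequality (`cgf_add_le`), used once forwards and once backwards, separates long from short
blocks. The short ones carry the proportion `G / (L + G)` of the variance, which is negligible for
large `L`. -/

theorem EReal.mul_log_le_of_le_exp {p : ENNReal} {s b : ℝ} (hs : 0 < s)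
    (h : p ≤ ENNReal.ofReal (Real.exp (b / s))) :
    ((s : ℝ) : EReal) * ENNReal.log p ≤ (b : EReal) := by
  have h1 : ENNReal.log p ≤ ((b / s : ℝ) : EReal) := by
    have := ENNReal.log_monotone h
    rwa [ENNReal.log_ofReal_of_pos (Real.exp_pos _), Real.log_exp] at this
  calc ((s : ℝ) : EReal) * ENNReal.log p ≤ (s : EReal) * ((b / s : ℝ) : EReal) :=
        mul_le_mul_of_nonneg_left h1 (by exact_mod_cast hs.le)
    _ = (b : EReal) := by rw [← EReal.coe_mul, mul_div_cancel₀ _ hs.ne']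

theorem EReal.le_mul_log_of_exp_le {p : ENNReal} {s b : ℝ} (hs : 0 < s)
    (h : ENNReal.ofReal (Real.exp (b / s)) ≤ p) :
    (b : EReal) ≤ ((s : ℝ) : EReal) * ENNReal.log p := by
  have h1 : ((b / s : ℝ) : EReal) ≤ ENNReal.log p := by
    have := ENNReal.log_monotone h
    rwa [ENNReal.log_ofReal_of_pos (Real.exp_pos _), Real.log_exp] at this
  calc (b : EReal) = (s : EReal) * ((b / s : ℝ) : EReal) := by
        rw [← EReal.coe_mul, mul_div_cancel₀ _ hs.ne']
    _ ≤ ((s : ℝ) : EReal) * ENNReal.log p :=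
        mul_le_mul_of_nonneg_left h1 (by exact_mod_cast hs.le)

/-! ### Gärtner–Ellis with a Gaussian limit. -/

section CumulantLimit

variable {Ω : Type*} [MeasurableSpace Ω] {P : Measure Ω} [IsProbabilityMeasure P]

/-- Exponential tilting without a change of measure: the mass that the tilted law gives to the
complement of a ball is controlled by two neighbouring exponential moments. -/
theorem mgf_le_exp_mul_measureReal_ball {X : Ω → ℝ} (hX : Measurable X)
    (hint : ∀ t : ℝ, Integrable (fun ω => Real.exp (t * X ω)) P) {v : ℝ} (hv : 0 ≤ v) (x : ℝ)
    {δ : ℝ} (hδ : 0 < δ) :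
    mgf X P (v * x) ≤ Real.exp (v * (x ^ 2 + |x| * δ)) * P.real (X ⁻¹' Metric.ball x δ)
      + Real.exp (-(v * (δ * (x + δ)))) * mgf X P (v * (x + δ))
      + Real.exp (v * (δ * (x - δ))) * mgf X P (v * (x - δ)) := by
  have hm : MeasurableSet (X ⁻¹' Metric.ball x δ) := hX Metric.isOpen_ball.measurableSet
  have hi1 : Integrable ((X ⁻¹' Metric.ball x δ).indicator
      (fun _ => Real.exp (v * (x ^ 2 + |x| * δ)))) P :=
    (integrable_const _).indicator hm
  have hi2 := (hint (v * (x + δ))).const_mul (Real.exp (-(v * (δ * (x + δ)))))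
  have hi3 := (hint (v * (x - δ))).const_mul (Real.exp (v * (δ * (x - δ))))
  have key : mgf X P (v * x) ≤ ∫ ω, ((X ⁻¹' Metric.ball x δ).indicator
      (fun _ => Real.exp (v * (x ^ 2 + |x| * δ))) ω
      + Real.exp (-(v * (δ * (x + δ)))) * Real.exp (v * (x + δ) * X ω)
      + Real.exp (v * (δ * (x - δ))) * Real.exp (v * (x - δ) * X ω)) ∂P := by
    refine integral_mono (hint _) ((hi1.add hi2).add hi3) fun ω => ?_
    simp only
    have p1 : 0 ≤ (X ⁻¹' Metric.ball x δ).indicator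
      (fun _ => Real.exp (v * (x ^ 2 + |x| * δ))) ω :=
      Set.indicator_nonneg (fun _ _ => (Real.exp_pos _).le) _
    rw [← Real.exp_add, ← Real.exp_add]
    have p2 := (Real.exp_pos (-(v * (δ * (x + δ))) + v * (x + δ) * X ω)).le
    have p3 := (Real.exp_pos (v * (δ * (x - δ)) + v * (x - δ) * X ω)).le
    by_cases h : ω ∈ X ⁻¹' Metric.ball x δ
    · rw [Set.indicator_of_mem h] at p1 ⊢
      have hb : |X ω - x| < δ := by simpa [Real.dist_eq] using h
      have : Real.exp (v * x * X ω) ≤ Real.exp (v * (x ^ 2 + |x| * δ)) := by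
        apply Real.exp_le_exp.2
        rw [mul_assoc]
        apply mul_le_mul_of_nonneg_left _ hv
        have : x * (X ω - x) ≤ |x| * δ :=
          (le_abs_self _).trans (by rw [abs_mul]; gcongr)
        nlinarith
      linarith
    · have hb : δ ≤ |X ω - x| := by simpa [Real.dist_eq] using h
      -- Outside the ball, `exp (v * δ * (|X ω - x| - δ)) ≥ 1`; multiplying by it shifts the tilt
      -- from `x` to `x + δ` or `x - δ`.
      rcases le_abs.1 hb with hb | hb
      · have : Real.exp (v * x * X ω) ≤ Real.exp (-(v * (δ * (x + δ))) + v * (x + δ) * X ω) := by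
          apply Real.exp_le_exp.2
          have : 0 ≤ v * (δ * (X ω - x - δ)) :=
            mul_nonneg hv (mul_nonneg hδ.le (by linarith))
          nlinarith
        linarith
      · have : Real.exp (v * x * X ω) ≤ Real.exp (v * (δ * (x - δ)) + v * (x - δ) * X ω) := by
          apply Real.exp_le_exp.2
          have : 0 ≤ v * (δ * (x - δ - X ω)) :=
            mul_nonneg hv (mul_nonneg hδ.le (by linarith))
          nlinarith
        linarith
  refine key.trans_eq ?_
  have e1 := integral_add (hi1.add hi2) hi3
  have e2 := integral_add hi1 hi2
  simp only [Pi.add_apply] at e1 e2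
  rw [e1, e2, integral_const_mul, integral_const_mul, integral_indicator_const _ hm, smul_eq_mul, mul_comm (P.real _)]
  rfl

variable {X : ℕ → Ω → ℝ} {lam : ℕ → ℝ}

theorem eventually_mgf_le_exp (hlam : ∀ᶠ N in atTop, 0 < lam N)
    (hint : ∀ N, ∀ t : ℝ, Integrable (fun ω => Real.exp (t * X N ω)) P)
    (hcgf : ∀ θ : ℝ, Tendsto (fun N => lam N ^ 2 * cgf (X N) P ((lam N ^ 2)⁻¹ * θ)) atTop
      (𝓝 (θ ^ 2 / 2))) (θ : ℝ) {ε : ℝ} (hε : 0 < ε) :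
    ∀ᶠ N in atTop, mgf (X N) P ((lam N ^ 2)⁻¹ * θ)
      ≤ Real.exp ((lam N ^ 2)⁻¹ * (θ ^ 2 / 2 + ε)) := by
  filter_upwards [hlam, (hcgf θ).eventually_lt_const (show θ ^ 2 / 2 < θ ^ 2 / 2 + ε by linarith)]
    with N h0 h
  rw [← Real.log_le_iff_le_exp (mgf_pos (hint N _)), inv_mul_eq_div _ (_ + _),
    le_div_iff₀' (by positivity)]
  exact h.le

theorem eventually_exp_le_mgf (hlam : ∀ᶠ N in atTop, 0 < lam N)
    (hint : ∀ N, ∀ t : ℝ, Integrable (fun ω => Real.exp (t * X N ω)) P)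
    (hcgf : ∀ θ : ℝ, Tendsto (fun N => lam N ^ 2 * cgf (X N) P ((lam N ^ 2)⁻¹ * θ)) atTop
      (𝓝 (θ ^ 2 / 2))) (θ : ℝ) {ε : ℝ} (hε : 0 < ε) :
    ∀ᶠ N in atTop, Real.exp ((lam N ^ 2)⁻¹ * (θ ^ 2 / 2 - ε))
      ≤ mgf (X N) P ((lam N ^ 2)⁻¹ * θ) := by
  filter_upwards [hlam, (hcgf θ).eventually_const_lt (show θ ^ 2 / 2 - ε < θ ^ 2 / 2 by linarith)]
    with N h0 h
  rw [← Real.le_log_iff_exp_le (mgf_pos (hint N _)), inv_mul_eq_div _ (_ - _),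
    div_le_iff₀' (by positivity)]
  exact h.le

theorem tendsto_inv_sq_atTop (hlam : ∀ᶠ N in atTop, 0 < lam N)
    (hnull : Tendsto lam atTop (𝓝 0)) :
    Tendsto (fun N => (lam N ^ 2)⁻¹) atTop atTop := by
  refine Tendsto.inv_tendsto_nhdsGT_zero (tendsto_nhdsWithin_iff.2 ⟨?_, ?_⟩)
  · simpa using hnull.pow 2
  · filter_upwards [hlam] with N h
    exact pow_pos h 2

/-- Chernoff on both tails with the optimal tilt `±s / lam N ^ 2`; half of `ε` absorbs the cumulant
error, the other half the factor 2. -/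
theorem eventually_measureReal_le_exp (hlam : ∀ᶠ N in atTop, 0 < lam N)
    (hnull : Tendsto lam atTop (𝓝 0))
    (hint : ∀ N, ∀ t : ℝ, Integrable (fun ω => Real.exp (t * X N ω)) P)
    (hcgf : ∀ θ : ℝ, Tendsto (fun N => lam N ^ 2 * cgf (X N) P ((lam N ^ 2)⁻¹ * θ)) atTop
      (𝓝 (θ ^ 2 / 2))) {B : Set ℝ} {s : ℝ} (hs : 0 ≤ s) (hB : ∀ x ∈ B, s ≤ |x|)
    {ε : ℝ} (hε : 0 < ε) :
    ∀ᶠ N in atTop, P.real (X N ⁻¹' B) ≤ Real.exp ((-(s ^ 2 / 2) + ε) / lam N ^ 2) := by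
  have hv := tendsto_inv_sq_atTop hlam hnull
  filter_upwards [hlam, eventually_mgf_le_exp hlam hint hcgf s (half_pos hε),
    eventually_mgf_le_exp hlam hint hcgf (-s) (half_pos hε),
    (hv.atTop_mul_const (half_pos hε)).eventually_ge_atTop (Real.log 2)] with N h0 h1 h2 h3
  set v := (lam N ^ 2)⁻¹ with hvdef
  have v0 : 0 < v := by positivity
  have c1 := measure_ge_le_exp_mul_mgf (X := X N) (μ := P) s (mul_nonneg v0.le hs) (hint N _)
  have c2 := measure_le_le_exp_mul_mgf (X := X N) (μ := P) (-s) (t := v * -s)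
    (by nlinarith [mul_nonneg v0.le hs]) (hint N _)
  have hsub : X N ⁻¹' B ⊆ {ω | s ≤ X N ω} ∪ {ω | X N ω ≤ -s} := fun ω hω => by
    rcases le_abs.1 (hB _ hω) with h | h
    · exact Or.inl h
    · exact Or.inr (by simp only [Set.mem_ofPred_eq]; linarith)
  have e1 : Real.exp (-(v * s) * s) * mgf (X N) P (v * s) ≤
      Real.exp (v * (-(s ^ 2 / 2) + ε / 2)) := by
    refine (mul_le_mul_of_nonneg_left h1 (Real.exp_pos _).le).trans_eq ?_
    rw [← Real.exp_add]; ring_nf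
  have e2 : Real.exp (-(v * -s) * -s) * mgf (X N) P (v * -s) ≤
      Real.exp (v * (-(s ^ 2 / 2) + ε / 2)) := by
    refine (mul_le_mul_of_nonneg_left h2 (Real.exp_pos _).le).trans_eq ?_
    rw [← Real.exp_add]; ring_nf
  have h4 : 2 ≤ Real.exp (v * (ε / 2)) := by
    rw [← Real.log_le_iff_le_exp (by norm_num)]; exact h3
  calc P.real (X N ⁻¹' B) ≤ P.real {ω | s ≤ X N ω} + P.real {ω | X N ω ≤ -s} :=
        (measureReal_mono hsub).trans (measureReal_union_le _ _)
    _ ≤ 2 * Real.exp (v * (-(s ^ 2 / 2) + ε / 2)) := by linarith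
    _ ≤ Real.exp (v * (ε / 2)) * Real.exp (v * (-(s ^ 2 / 2) + ε / 2)) := by gcongr
    _ = Real.exp ((-(s ^ 2 / 2) + ε) / lam N ^ 2) := by
        rw [← Real.exp_add, div_eq_inv_mul _ (lam N ^ 2), ← hvdef]; ring_nf

theorem eventually_exp_le_measureReal_ball (hX : ∀ N, Measurable (X N))
    (hlam : ∀ᶠ N in atTop, 0 < lam N)
    (hnull : Tendsto lam atTop (𝓝 0))
    (hint : ∀ N, ∀ t : ℝ, Integrable (fun ω => Real.exp (t * X N ω)) P)
    (hcgf : ∀ θ : ℝ, Tendsto (fun N => lam N ^ 2 * cgf (X N) P ((lam N ^ 2)⁻¹ * θ)) atTop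
      (𝓝 (θ ^ 2 / 2))) (x : ℝ) {δ : ℝ} (hδ : 0 < δ) :
    ∀ᶠ N in atTop, Real.exp ((-(x ^ 2 / 2) - (|x| * δ + δ ^ 2)) / lam N ^ 2)
      ≤ P.real (X N ⁻¹' Metric.ball x δ) := by
  have hv := tendsto_inv_sq_atTop hlam hnull
  have hη : 0 < δ ^ 2 / 8 := by positivity
  filter_upwards [hlam, eventually_exp_le_mgf hlam hint hcgf x hη,
    eventually_mgf_le_exp hlam hint hcgf (x + δ) hη,
    eventually_mgf_le_exp hlam hint hcgf (x - δ) hη,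
    (hv.atTop_mul_const (show 0 < δ ^ 2 / 4 by positivity)).eventually_ge_atTop (Real.log 4)]
    with N h0 h1 h2 h3 h4
  set v := (lam N ^ 2)⁻¹ with hvdef
  have v0 : 0 < v := by positivity
  have key := mgf_le_exp_mul_measureReal_ball (hX N) (hint N) v0.le x hδ
  have h5 : 4 ≤ Real.exp (v * (δ ^ 2 / 4)) := by
    rw [← Real.log_le_iff_le_exp (by norm_num)]; exact h4
  -- Completing the square, each side term costs `δ ^ 2 / 2` against the centre, of which the
  -- cumulant error `δ ^ 2 / 8` is lost: both are at most `W`. The tilted total is at least `4 * W`,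
  -- so the ball retains `2 * W`.
  set W := Real.exp (v * (x ^ 2 / 2 - 3 * δ ^ 2 / 8)) with hW
  have e1 : Real.exp (-(v * (δ * (x + δ)))) * mgf (X N) P (v * (x + δ)) ≤ W := by
    refine (mul_le_mul_of_nonneg_left h2 (Real.exp_pos _).le).trans_eq ?_
    rw [← Real.exp_add, hW]; ring_nf
  have e2 : Real.exp (v * (δ * (x - δ))) * mgf (X N) P (v * (x - δ)) ≤ W := by
    refine (mul_le_mul_of_nonneg_left h3 (Real.exp_pos _).le).trans_eq ?_
    rw [← Real.exp_add, hW]; ring_nf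
  have e3 : 4 * W ≤ Real.exp (v * (x ^ 2 / 2 - δ ^ 2 / 8)) := by
    refine (mul_le_mul_of_nonneg_right h5 (Real.exp_pos _).le).trans_eq ?_
    rw [← Real.exp_add]; ring_nf
  have e4 : 2 * W ≤ Real.exp (v * (x ^ 2 + |x| * δ)) * P.real (X N ⁻¹' Metric.ball x δ) := by
    linarith
  have e5 : Real.exp (v * (x ^ 2 + |x| * δ)) *
      Real.exp ((-(x ^ 2 / 2) - (|x| * δ + δ ^ 2)) / lam N ^ 2) ≤ W := by
    rw [← Real.exp_add, hW, div_eq_inv_mul _ (lam N ^ 2), ← hvdef]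
    apply Real.exp_le_exp.2
    have : 0 ≤ v * δ ^ 2 := by positivity
    nlinarith
  have W0 : 0 < W := Real.exp_pos _
  exact le_of_mul_le_mul_left (e5.trans (by linarith)) (Real.exp_pos (v * (x ^ 2 + |x| * δ)))

/-- The Gärtner–Ellis theorem for a Gaussian limiting cumulant generating function. -/
theorem satisfiesMDP_one_of_tendsto_cgf (hX : ∀ N, Measurable (X N))
    (hlam : ∀ᶠ N in atTop, 0 < lam N)
    (hnull : Tendsto lam atTop (𝓝 0))
    (hint : ∀ N, ∀ t : ℝ, Integrable (fun ω => Real.exp (t * X N ω)) P)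
    (hcgf : ∀ θ : ℝ, Tendsto (fun N => lam N ^ 2 * cgf (X N) P ((lam N ^ 2)⁻¹ * θ)) atTop
      (𝓝 (θ ^ 2 / 2))) :
    SatisfiesMDP P X lam 1 := by
  refine ⟨one_pos, hX, fun B _ => ⟨?_, liminf_le_limsup, ?_⟩⟩
  · rw [EReal.neg_le]
    refine le_iInf₂ fun x hx => ?_
    rw [EReal.neg_le]
    refine EReal.ge_of_forall_gt_iff_ge.1 fun b hb => ?_
    have hb' : b < -(x ^ 2 / 2) := by
      rw [← EReal.coe_neg] at hb
      have := EReal.coe_lt_coe_iff.1 hb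
      simpa using this
    obtain ⟨r, r0, hr⟩ := Metric.isOpen_iff.1 isOpen_interior x hx
    obtain ⟨δ, hδ0, hδr, hδ⟩ : ∃ δ : ℝ, 0 < δ ∧ δ ≤ r ∧ |x| * δ + δ ^ 2 ≤ -(x ^ 2 / 2) - b := by
      have ht : Tendsto (fun δ : ℝ => |x| * δ + δ ^ 2) (𝓝[>] 0) (𝓝 0) := by
        have : Continuous (fun δ : ℝ => |x| * δ + δ ^ 2) := by fun_prop
        simpa using (this.tendsto 0).mono_left nhdsWithin_le_nhds
      have := (ht.eventually_lt_const (show (0 : ℝ) < -(x ^ 2 / 2) - b by linarith)).and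
        (eventually_mem_nhdsWithin.and (Ioc_mem_nhdsGT r0))
      obtain ⟨δ, h1, h2, h3⟩ := this.exists
      exact ⟨δ, h2, h3.2, h1.le⟩
    refine le_liminf_of_le (by isBoundedDefault) ?_
    filter_upwards [hlam, eventually_exp_le_measureReal_ball hX hlam hnull hint hcgf x hδ0]
      with N h0 h
    refine EReal.le_mul_log_of_exp_le (by positivity) ?_
    rw [ENNReal.ofReal_le_iff_le_toReal (measure_ne_top _ _)]
    calc Real.exp (b / lam N ^ 2)
        ≤ Real.exp ((-(x ^ 2 / 2) - (|x| * δ + δ ^ 2)) / lam N ^ 2) := by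
          apply Real.exp_le_exp.2
          gcongr
          linarith
      _ ≤ P.real (X N ⁻¹' Metric.ball x δ) := h
      _ ≤ P.real (X N ⁻¹' B) := measureReal_mono (Set.preimage_mono
          ((Metric.ball_subset_ball hδr).trans (hr.trans interior_subset)))
  · rw [EReal.le_neg]
    refine EReal.ge_of_forall_gt_iff_ge.1 fun c hc => ?_
    obtain ⟨c', hcc', hc'⟩ := EReal.lt_iff_exists_real_btwn.1 hc
    have hcc'' : c < c' := EReal.coe_lt_coe_iff.1 hcc'
    -- The truncation at 0 allows negative `c'`. Working with reals below the infimum also covers an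
    -- infinite infimum, that is, empty `B`.
    have hB : ∀ x ∈ B, √(2 * max c' 0) ≤ |x| := fun x hx => by
      apply Real.sqrt_le_iff.2 ⟨abs_nonneg _, ?_⟩
      rw [sq_abs]
      have := EReal.coe_lt_coe_iff.1 (hc'.trans_le (iInf₂_le x (subset_closure hx)))
      rcases max_cases c' 0 with ⟨h, _⟩ | ⟨h, _⟩ <;> rw [h] <;> nlinarith [sq_nonneg x]
    rw [EReal.le_neg, ← EReal.coe_neg]
    refine limsup_le_of_le (by isBoundedDefault) ?_
    filter_upwards [hlam, eventually_measureReal_le_exp hlam hnull hint hcgf (Real.sqrt_nonneg _)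
      hB (sub_pos.2 hcc'')] with N h0 h
    refine EReal.mul_log_le_of_le_exp (by positivity) ?_
    rw [← ofReal_measureReal]
    refine ENNReal.ofReal_le_ofReal (h.trans (Real.exp_le_exp.2 ?_))
    rw [Real.sq_sqrt (by positivity)]
    gcongr
    linarith [le_max_left c' 0]

end CumulantLimit

/-! ### Cosine polynomials with frequencies in a window. -/

noncomputable section CosineSpan

/-- The cosine polynomials `∑ c_f cos (2π f x)` whose frequencies `f : ℕ` lie in `[lo, hi]`. -/
def cosSpan (lo hi : ℝ) : Submodule ℝ (ℝ → ℝ) :=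
  Submodule.span ℝ ((fun (f : ℕ) (x : ℝ) => Real.cos (2 * Real.pi * f * x)) ''
    {f : ℕ | lo ≤ f ∧ (f : ℝ) ≤ hi})

theorem cos_mem_cosSpan {lo hi : ℝ} {f : ℕ} (h1 : lo ≤ f) (h2 : (f : ℝ) ≤ hi) :
    (fun x : ℝ => Real.cos (2 * Real.pi * f * x)) ∈ cosSpan lo hi :=
  Submodule.subset_span ⟨f, ⟨h1, h2⟩, rfl⟩

theorem cosSpan_mono {lo hi lo' hi' : ℝ} (h1 : lo' ≤ lo) (h2 : hi ≤ hi') :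
    cosSpan lo hi ≤ cosSpan lo' hi' :=
  Submodule.span_mono (Set.image_mono fun _ h => ⟨h1.trans h.1, h.2.trans h2⟩)

theorem one_mem_cosSpan {hi : ℝ} (h : 0 ≤ hi) : (1 : ℝ → ℝ) ∈ cosSpan 0 hi := by
  convert cos_mem_cosSpan (f := 0) (lo := 0) (hi := hi) (by simp) (by simpa using h) using 1
  ext x
  simp

theorem cos_mul_cos_mem_cosSpan {lo hi : ℝ} {f g : ℕ} (hgf : g ≤ f) (h1 : lo ≤ (f : ℝ) - g)
    (h2 : (f : ℝ) + g ≤ hi) :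
    (fun x : ℝ => Real.cos (2 * Real.pi * f * x) * Real.cos (2 * Real.pi * g * x))
      ∈ cosSpan lo hi := by
  have g0 : (0 : ℝ) ≤ g := g.cast_nonneg
  have hs : (fun x : ℝ => Real.cos (2 * Real.pi * f * x) * Real.cos (2 * Real.pi * g * x))
      = (1 / 2 : ℝ) • ((fun x : ℝ => Real.cos (2 * Real.pi * ((f - g : ℕ) : ℝ) * x))
        + (fun x : ℝ => Real.cos (2 * Real.pi * ((f + g : ℕ) : ℝ) * x))) := by
    ext x
    simp only [Pi.smul_apply, Pi.add_apply, smul_eq_mul]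
    push_cast [Nat.cast_sub hgf]
    rw [show 2 * Real.pi * ((f : ℝ) - g) * x
        = 2 * Real.pi * f * x - 2 * Real.pi * g * x by ring,
      show 2 * Real.pi * ((f : ℝ) + g) * x
        = 2 * Real.pi * f * x + 2 * Real.pi * g * x by ring, Real.cos_sub, Real.cos_add]
    ring
  rw [hs]
  refine Submodule.smul_mem _ _ (Submodule.add_mem _ (cos_mem_cosSpan ?_ ?_)
    (cos_mem_cosSpan ?_ ?_)) <;> push_cast [Nat.cast_sub hgf] <;> linarith

/-- Product-to-sum moves each frequency of `u` by at most `K`; `K ≤ lo` keeps the differences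
nonnegative. -/
theorem mul_mem_cosSpan {lo hi K : ℝ} (hK : K ≤ lo) {u w : ℝ → ℝ} (hu : u ∈ cosSpan lo hi)
    (hw : w ∈ cosSpan 0 K) : u * w ∈ cosSpan (lo - K) (hi + K) := by
  induction hu using Submodule.span_induction with
  | zero => simp
  | add a b _ _ ha hb => rw [add_mul]; exact Submodule.add_mem _ ha hb
  | smul c a _ ha => rw [smul_mul_assoc]; exact Submodule.smul_mem _ _ ha
  | mem a ha =>
    obtain ⟨f, ⟨f1, f2⟩, rfl⟩ := ha
    induction hw using Submodule.span_induction with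
    | zero => simp
    | add a b _ _ ha hb => rw [mul_add]; exact Submodule.add_mem _ ha hb
    | smul c a _ ha => rw [mul_smul_comm]; exact Submodule.smul_mem _ _ ha
    | mem a ha =>
      obtain ⟨g, ⟨g1, g2⟩, rfl⟩ := ha
      exact cos_mul_cos_mem_cosSpan (by exact_mod_cast (g2.trans (hK.trans f1)))
        (by linarith) (by linarith)

theorem continuous_of_mem_cosSpan {lo hi : ℝ} {u : ℝ → ℝ} (hu : u ∈ cosSpan lo hi) :
    Continuous u := by
  induction hu using Submodule.span_induction with
  | zero => exact continuous_zero
  | add a b _ _ ha hb => exact ha.add hb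
  | smul c a _ ha => exact ha.const_smul c
  | mem a ha =>
    obtain ⟨f, _, rfl⟩ := ha
    fun_prop

instance : IsProbabilityMeasure unitIntervalMeasure :=
  ⟨by simp [unitIntervalMeasure]⟩

theorem Continuous.integrable_unitIntervalMeasure {f : ℝ → ℝ} (hf : Continuous f) :
    Integrable f unitIntervalMeasure :=
  (hf.continuousOn.integrableOn_compact (isCompact_Icc (a := (0 : ℝ)) (b := 1))).mono_set
    Set.Ioo_subset_Icc_self

theorem integral_cos_eq_zero {f : ℕ} (hf : f ≠ 0) :
    ∫ x, Real.cos (2 * Real.pi * f * x) ∂unitIntervalMeasure = 0 := by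
  have hc : 2 * Real.pi * f ≠ 0 := by positivity
  rw [unitIntervalMeasure, ← integral_Ioc_eq_integral_Ioo,
    ← intervalIntegral.integral_of_le zero_le_one,
    intervalIntegral.integral_comp_mul_left (fun y => Real.cos y) hc, integral_cos]
  have : Real.sin (2 * Real.pi * f) = 0 := by
    rw [show 2 * Real.pi * (f : ℝ) = ((2 * f : ℕ) : ℝ) * Real.pi by push_cast; ring]
    exact Real.sin_nat_mul_pi _
  simp [this]

theorem integral_eq_zero_of_mem_cosSpan {lo hi : ℝ} (hlo : 0 < lo) {u : ℝ → ℝ}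
    (hu : u ∈ cosSpan lo hi) : ∫ x, u x ∂unitIntervalMeasure = 0 := by
  induction hu using Submodule.span_induction with
  | zero => simp
  | add a b ha' hb' ha hb =>
    have := integral_add (continuous_of_mem_cosSpan ha').integrable_unitIntervalMeasure
      (continuous_of_mem_cosSpan hb').integrable_unitIntervalMeasure
    simp only [Pi.add_apply]
    rw [this, ha, hb, add_zero]
  | smul c a _ ha => simp [integral_const_mul, ha]
  | mem a ha =>
    obtain ⟨f, ⟨f1, _⟩, rfl⟩ := ha
    refine integral_cos_eq_zero ?_
    rintro rfl
    simp at f1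
    linarith

end CosineSpan

/-! ### Lacunary blocks and their exact decorrelation. -/

noncomputable section Blocks

/-- The sum of `√2 cos (2π m_k x)` over the block of indices `a ≤ k < a + l`. -/
def blockSum (m : ℕ → ℕ) (a l : ℕ) (x : ℝ) : ℝ :=
  ∑ i ∈ Finset.range l, √2 * Real.cos (2 * Real.pi * m (a + i) * x)

/-- A sequence of positive integers, indexed from `0`, with ratios at least `q > 1`. -/
structure IsLacunary (m : ℕ → ℕ) (q : ℝ) : Prop where
  one_lt : 1 < q
  pos : ∀ k, 0 < m k
  mul_le : ∀ k, q * m k ≤ m (k + 1)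

namespace IsLacunary

variable {m : ℕ → ℕ} {q : ℝ} (hm : IsLacunary m q)

include hm

theorem pow_mul_le (k d : ℕ) : q ^ d * m k ≤ m (k + d) := by
  induction d with
  | zero => simp
  | succ d ih =>
    have := hm.mul_le (k + d)
    have q0 : 0 < q := by linarith [hm.one_lt]
    calc q ^ (d + 1) * m k = q * (q ^ d * m k) := by ring
      _ ≤ q * m (k + d) := by gcongr
      _ ≤ _ := this

theorem mono {k l : ℕ} (h : k ≤ l) : (m k : ℝ) ≤ m l := by
  obtain ⟨d, rfl⟩ := Nat.exists_eq_add_of_le h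
  refine le_trans ?_ (hm.pow_mul_le k d)
  exact le_mul_of_one_le_left (Nat.cast_nonneg _) (one_le_pow₀ hm.one_lt.le)

theorem le_sub_of_lt {a k l : ℕ} (hk : a ≤ k) (hl : k < l) :
    (1 - q⁻¹) * m a ≤ (m l : ℝ) - m k := by
  have q1 := hm.one_lt
  have q0 : 0 < q := by linarith
  have h1 : q * m k ≤ m l := (hm.mul_le k).trans (hm.mono hl)
  have h2 := hm.mono hk
  have h3 : q⁻¹ < 1 := inv_lt_one_of_one_lt₀ q1
  have h5 : (1 - q⁻¹) * m a ≤ (1 - q⁻¹) * m k := by gcongr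
  have h4 : (1 - q⁻¹) * m k ≤ (q - 1) * m k := by
    refine mul_le_mul_of_nonneg_right ?_ (Nat.cast_nonneg _)
    nlinarith [mul_inv_cancel₀ q0.ne', inv_pos.2 q0]
  linarith

theorem blockSum_mem_cosSpan (a l : ℕ) :
    blockSum m a l ∈ cosSpan ((1 - q⁻¹) * m a) (2 * m (a + l)) := by
  have h3 : 0 < q⁻¹ := inv_pos.2 (by linarith [hm.one_lt])
  have : blockSum m a l = ∑ i ∈ Finset.range l,
      (√2 : ℝ) • (fun x : ℝ => Real.cos (2 * Real.pi * m (a + i) * x)) := by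
    ext x
    simp [blockSum]
  rw [this]
  refine Submodule.sum_mem _ fun i hi => Submodule.smul_mem _ _ (cos_mem_cosSpan ?_ ?_)
  · have := hm.mono (Nat.le_add_right a i)
    have : (0 : ℝ) ≤ m a := Nat.cast_nonneg _
    nlinarith
  · have := hm.mono (show a + i ≤ a + l by have := Finset.mem_range.1 hi; omega)
    have : (0 : ℝ) ≤ m (a + l) := Nat.cast_nonneg _
    linarith

/-- Off-diagonal products have frequencies `m j ± m i`, kept away from 0 by `le_sub_of_lt`; each
diagonal term is `1` plus a cosine of doubled frequency, so `l` is the mean of the square. -/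
theorem blockSum_sq_sub_mem_cosSpan (a l : ℕ) :
    (fun x => blockSum m a l x ^ 2 - l) ∈ cosSpan ((1 - q⁻¹) * m a) (2 * m (a + l)) := by
  have h3 : 0 < q⁻¹ := inv_pos.2 (by linarith [hm.one_lt])
  have hs : (fun x => blockSum m a l x ^ 2 - l) = ∑ i ∈ Finset.range l, ∑ j ∈ Finset.range l,
      (fun x : ℝ => 2 * (Real.cos (2 * Real.pi * m (a + i) * x)
        * Real.cos (2 * Real.pi * m (a + j) * x)) - if i = j then 1 else 0) := by
    ext x
    simp only [Finset.sum_apply, Finset.sum_sub_distrib, Finset.sum_ite_eq, Finset.mem_range]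
    rw [blockSum, sq, Finset.sum_mul_sum]
    congr 1
    · refine Finset.sum_congr rfl fun i _ => Finset.sum_congr rfl fun j _ => ?_
      have : √2 * √2 = (2 : ℝ) := Real.mul_self_sqrt (by norm_num)
      linear_combination (Real.cos (2 * Real.pi * m (a + i) * x)
        * Real.cos (2 * Real.pi * m (a + j) * x)) * this
    · rw [Finset.sum_congr rfl (g := fun _ => (1 : ℝ))
        (fun i hi => if_pos (Finset.mem_range.1 hi))]
      simp
  rw [hs]
  have hoff : ∀ i j : ℕ, i < j → j < l → (fun x : ℝ => 2 * (Real.cos (2 * Real.pi * m (a + j) * x)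
        * Real.cos (2 * Real.pi * m (a + i) * x)))
        ∈ cosSpan ((1 - q⁻¹) * m a) (2 * m (a + l)) := fun i j hij hj =>
    Submodule.smul_mem _ (2 : ℝ) (cos_mul_cos_mem_cosSpan
      (by exact_mod_cast hm.mono (show a + i ≤ a + j by omega))
      (hm.le_sub_of_lt (by omega) (by omega))
      (by linarith [hm.mono (show a + i ≤ a + l by omega),
            hm.mono (show a + j ≤ a + l by omega)]))
  refine Submodule.sum_mem _ fun i hi => Submodule.sum_mem _ fun j hj => ?_
  rw [Finset.mem_range] at hi hj
  rcases lt_trichotomy i j with h | rfl | h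
  · convert hoff i j h hj using 1
    ext x
    simp only [h.ne, if_false]
    ring
  · convert cos_mem_cosSpan (f := 2 * m (a + i)) (lo := (1 - q⁻¹) * m a) (hi := 2 * m (a + l))
      ?_ ?_ using 1
    · ext x
      simp only [if_true]
      push_cast
      rw [show 2 * Real.pi * (2 * (m (a + i) : ℝ)) * x
        = 2 * (2 * Real.pi * m (a + i) * x) by ring, Real.cos_two_mul]
      ring
    · have := hm.mono (Nat.le_add_right a i)
      have : (0 : ℝ) ≤ m a := Nat.cast_nonneg _
      push_cast
      nlinarith
    · push_cast
      linarith [hm.mono (show a + i ≤ a + l by omega)]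
  · convert hoff j i h hi using 1
    ext x
    simp only [h.ne', if_false]
    ring

/-- Second-order factors over blocks separated by gaps of a fixed length are uncorrelated. -/
theorem exists_gap_forall_integral_prod_eq : ∃ G : ℕ, ∀ (p r l : ℕ), l + G ≤ p → ∀ (t : ℝ) (J : ℕ),
    ∫ x, ∏ j ∈ Finset.range J, (1 + t * blockSum m (j * p + r) l x
      + t ^ 2 * blockSum m (j * p + r) l x ^ 2 / 2) ∂unitIntervalMeasure
      = (1 + t ^ 2 * l / 2) ^ J := by
  have q1 := hm.one_lt
  have h3 : q⁻¹ < 1 := inv_lt_one_of_one_lt₀ q1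
  -- Half of the block's lower frequency constant: if the past has frequencies at most `C * m a`,
  -- its product with the centred factor still has frequencies at least `C * m a > 0`. `G` is chosen
  -- with `q ^ G * C ≥ C + 2`, which restores this bound at the next block.
  set C := (1 - q⁻¹) / 2 with hC
  have C0 : 0 < C := by rw [hC]; linarith
  obtain ⟨G, hG⟩ := ((tendsto_pow_atTop_atTop_of_one_lt q1).eventually_ge_atTop
    ((C + 2) / C)).exists
  rw [div_le_iff₀ C0] at hG
  refine ⟨G, fun p r l hp t J => ?_⟩
  suffices h : (fun x => ∏ j ∈ Finset.range J, (1 + t * blockSum m (j * p + r) l x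
      + t ^ 2 * blockSum m (j * p + r) l x ^ 2 / 2)) ∈ cosSpan 0 (C * m (J * p + r)) ∧
      ∫ x, ∏ j ∈ Finset.range J, (1 + t * blockSum m (j * p + r) l x
      + t ^ 2 * blockSum m (j * p + r) l x ^ 2 / 2) ∂unitIntervalMeasure
      = (1 + t ^ 2 * l / 2) ^ J from h.2
  induction J with
  | zero => exact ⟨by simpa using! one_mem_cosSpan (by positivity), by simp⟩
  | succ J ih =>
    obtain ⟨ih1, ih2⟩ := ih
    set F : ℝ → ℝ := fun x => ∏ j ∈ Finset.range J, (1 + t * blockSum m (j * p + r) l x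
      + t ^ 2 * blockSum m (j * p + r) l x ^ 2 / 2) with hF
    set a := J * p + r with ha
    have hQ : (t • blockSum m a l + (t ^ 2 / 2) • fun x => blockSum m a l x ^ 2 - l)
        ∈ cosSpan ((1 - q⁻¹) * m a) (2 * m (a + l)) :=
      Submodule.add_mem _ (Submodule.smul_mem _ _ (hm.blockSum_mem_cosSpan a l))
        (Submodule.smul_mem _ _ (hm.blockSum_sq_sub_mem_cosSpan a l))
    set Q := t • blockSum m a l + (t ^ 2 / 2) • fun x => blockSum m a l x ^ 2 - l with hQdef
    have ma : (0 : ℝ) < m a := Nat.cast_pos.2 (hm.pos a)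
    have hCa : C * m a < (1 - q⁻¹) * m a := by
      have : 1 - q⁻¹ = 2 * C := by rw [hC]; ring
      rw [this]
      have := mul_pos C0 ma
      linarith
    have hQF := mul_mem_cosSpan hCa.le hQ ih1
    have hprod : (fun x => ∏ j ∈ Finset.range (J + 1), (1 + t * blockSum m (j * p + r) l x
      + t ^ 2 * blockSum m (j * p + r) l x ^ 2 / 2)) = (1 + t ^ 2 * l / 2) • F + Q * F := by
      ext x
      rw [Finset.prod_range_succ]
      simp only [hQdef, hF, Pi.add_apply, Pi.smul_apply, Pi.mul_apply, smul_eq_mul]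
      ring
    constructor
    · rw [hprod]
      have hstep : C * m a + 2 * m (a + l) ≤ C * m ((J + 1) * p + r) := by
        have e1 := hm.mono (Nat.le_add_right a l)
        have e2 := hm.pow_mul_le (a + l) G
        have e3 := hm.mono (show a + l + G ≤ (J + 1) * p + r by rw [ha, add_mul]; omega)
        calc C * m a + 2 * m (a + l) ≤ (C + 2) * m (a + l) := by
              rw [add_mul]; gcongr
          _ ≤ q ^ G * C * m (a + l) := by gcongr
          _ = C * (q ^ G * m (a + l)) := by ring
          _ ≤ C * m ((J + 1) * p + r) := by gcongr; exact e2.trans e3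
      have : (0 : ℝ) ≤ m (a + l) := Nat.cast_nonneg _
      refine Submodule.add_mem _ (Submodule.smul_mem _ _ (cosSpan_mono le_rfl (by linarith) ih1))
        (cosSpan_mono (by linarith) (by linarith) hQF)
    · rw [hprod]
      rw [integral_add' (((continuous_of_mem_cosSpan ih1).const_smul _).integrable_unitIntervalMeasure)
        (continuous_of_mem_cosSpan hQF).integrable_unitIntervalMeasure,
        integral_eq_zero_of_mem_cosSpan (by linarith) hQF]
      simp only [Pi.smul_apply, smul_eq_mul]
      rw [integral_const_mul, ih2, add_zero, mul_comm, ← pow_succ]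

end IsLacunary

end Blocks

/-! ### Multiplicative Taylor bounds for the exponential. -/

section ExpBounds

theorem abs_exp_sub_quadratic_le {y : ℝ} (hy : |y| ≤ 1) :
    |Real.exp y - (1 + y + y ^ 2 / 2)| ≤ |y| ^ 3 * (2 / 9) := by
  have := Real.exp_bound hy (n := 3) (by norm_num)
  simp only [Finset.sum_range_succ, Finset.sum_range_zero] at this
  norm_num [Nat.factorial] at this
  exact this

/-- The quadratic is at least `1 / 2`, so the additive cubic error becomes a factor, which can be
multiplied over blocks. -/
theorem exp_le_quadratic_mul_exp {y : ℝ} (hy : |y| ≤ 1) :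
    Real.exp y ≤ (1 + y + y ^ 2 / 2) * Real.exp (3 * |y| ^ 3) := by
  have h1 := (abs_le.1 (abs_exp_sub_quadratic_le hy)).2
  have h2 : 1 / 2 ≤ 1 + y + y ^ 2 / 2 := by nlinarith [sq_nonneg (y + 1)]
  have h3 := Real.add_one_le_exp (3 * |y| ^ 3)
  have h4 : 0 ≤ |y| ^ 3 := by positivity
  calc Real.exp y ≤ (1 + y + y ^ 2 / 2) * (3 * |y| ^ 3 + 1) := by
        nlinarith [mul_nonneg h4 (sub_nonneg.2 h2)]
    _ ≤ _ := by gcongr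

theorem quadratic_le_exp_mul_exp {y : ℝ} (hy : |y| ≤ 1) :
    1 + y + y ^ 2 / 2 ≤ Real.exp y * Real.exp (3 * |y| ^ 3) := by
  have h1 := (abs_le.1 (abs_exp_sub_quadratic_le hy)).1
  have h3 := Real.add_one_le_exp (3 * |y| ^ 3)
  have h4 : 0 ≤ |y| ^ 3 := by positivity
  have h5 : 1 ≤ 3 * Real.exp y := by
    have e1 : 1 ≤ Real.exp 1 * Real.exp y := by
      rw [← Real.exp_add]
      exact Real.one_le_exp (by linarith [(abs_le.1 hy).1])
    have := Real.exp_one_lt_d9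
    nlinarith [Real.exp_pos y]
  calc 1 + y + y ^ 2 / 2 ≤ Real.exp y * (3 * |y| ^ 3 + 1) := by
        nlinarith [mul_nonneg h4 (sub_nonneg.2 h5)]
    _ ≤ _ := by gcongr

end ExpBounds

/-! ### Hölder and perturbation bounds for cumulants. -/

section Cgf

variable {Ω : Type*} [MeasurableSpace Ω] {P : Measure Ω} [IsProbabilityMeasure P]

/-- Hölder's inequality for cumulant generating functions. -/
theorem cgf_add_le {X Y : Ω → ℝ} {t α β : ℝ} (hα : 0 < α) (hβ : 0 < β) (hαβ : α + β = 1)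
    (hX : Integrable (fun ω => Real.exp (t / α * X ω)) P)
    (hY : Integrable (fun ω => Real.exp (t / β * Y ω)) P)
    (hXY : Integrable (fun ω => Real.exp (t * (X + Y) ω)) P) :
    cgf (X + Y) P t ≤ α * cgf X P (t / α) + β * cgf Y P (t / β) := by
  set K := α * cgf X P (t / α) + β * cgf Y P (t / β) with hK
  have key : ∫ ω, Real.exp (-K) * Real.exp (t * (X + Y) ω) ∂P ≤
      ∫ ω, (α * Real.exp (-cgf X P (t / α)) * Real.exp (t / α * X ω)
        + β * Real.exp (-cgf Y P (t / β)) * Real.exp (t / β * Y ω)) ∂P := by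
    refine integral_mono (hXY.const_mul _) ((hX.const_mul _).add (hY.const_mul _)) fun ω => ?_
    -- Young's inequality between the two normalised exponential densities, each of integral 1.
    have := convexOn_exp.2 (Set.mem_univ (-cgf X P (t / α) + t / α * X ω))
      (Set.mem_univ (-cgf Y P (t / β) + t / β * Y ω)) hα.le hβ.le hαβ
    simp only [smul_eq_mul] at this
    simp only [mul_assoc]
    rw [← Real.exp_add, ← Real.exp_add, ← Real.exp_add]
    refine le_trans (le_of_eq ?_) this
    congr 1
    simp only [Pi.add_apply, hK]
    field_simp
    ring
  rw [integral_const_mul, integral_add (hX.const_mul _) (hY.const_mul _), integral_const_mul,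
    integral_const_mul] at key
  have eX : Real.exp (-cgf X P (t / α)) * ∫ ω, Real.exp (t / α * X ω) ∂P = 1 := by
    rw [show ∫ ω, Real.exp (t / α * X ω) ∂P = Real.exp (cgf X P (t / α)) from
      (exp_cgf hX).symm, ← Real.exp_add]
    simp
  have eY : Real.exp (-cgf Y P (t / β)) * ∫ ω, Real.exp (t / β * Y ω) ∂P = 1 := by
    rw [show ∫ ω, Real.exp (t / β * Y ω) ∂P = Real.exp (cgf Y P (t / β)) from
      (exp_cgf hY).symm, ← Real.exp_add]
    simp
  rw [mul_assoc, eX, mul_assoc, eY, mul_one, mul_one, hαβ,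
    show ∫ ω, Real.exp (t * (X + Y) ω) ∂P = Real.exp (cgf (X + Y) P t) from
      (exp_cgf hXY).symm, ← Real.exp_add, Real.exp_le_one_iff] at key
  linarith

theorem cgf_le_of_abs_sub_le {X Y : Ω → ℝ} {t c : ℝ} (h : ∀ ω, |X ω - Y ω| ≤ c)
    (hX : Integrable (fun ω => Real.exp (t * X ω)) P)
    (hY : Integrable (fun ω => Real.exp (t * Y ω)) P) :
    cgf X P t ≤ |t| * c + cgf Y P t := by
  have key : mgf X P t ≤ ∫ ω, Real.exp (|t| * c) * Real.exp (t * Y ω) ∂P := by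
    refine integral_mono hX (hY.const_mul _) fun ω => ?_
    simp only
    rw [← Real.exp_add]
    apply Real.exp_le_exp.2
    have : t * (X ω - Y ω) ≤ |t| * c := (le_abs_self _).trans (by
      rw [abs_mul]
      gcongr
      exact h ω)
    linarith
  rw [integral_const_mul] at key
  have h2 := Real.log_le_log (mgf_pos hX) key
  rwa [show ∫ ω, Real.exp (t * Y ω) ∂P = Real.exp (cgf Y P t) from (exp_cgf hY).symm,
    ← Real.exp_add, Real.log_exp] at h2

end Cgf

/-! ### Cumulants of sums over separated blocks. -/

section BlockCgf

theorem continuous_blockSum (m : ℕ → ℕ) (a l : ℕ) : Continuous (blockSum m a l) := by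
  unfold blockSum
  fun_prop

theorem abs_blockSum_le (m : ℕ → ℕ) (a l : ℕ) (x : ℝ) : |blockSum m a l x| ≤ 2 * l := by
  have h2 : √2 ≤ 2 := Real.sqrt_le_iff.2 (by norm_num)
  calc |blockSum m a l x| ≤ ∑ i ∈ Finset.range l, |√2 * Real.cos (2 * Real.pi * m (a + i) * x)| :=
        Finset.abs_sum_le_sum_abs _ _
    _ ≤ ∑ i ∈ Finset.range l, 2 := by
        refine Finset.sum_le_sum fun i _ => ?_
        rw [abs_mul, abs_of_nonneg (Real.sqrt_nonneg _)]
        nlinarith [Real.abs_cos_le_one (2 * Real.pi * m (a + i) * x), Real.sqrt_nonneg 2,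
          abs_nonneg (Real.cos (2 * Real.pi * m (a + i) * x))]
    _ = 2 * l := by simp [mul_comm]

theorem blockSum_add (m : ℕ → ℕ) (a k l : ℕ) (x : ℝ) :
    blockSum m a (k + l) x = blockSum m a k x + blockSum m (a + k) l x := by
  simp only [blockSum, Finset.sum_range_add, add_assoc]

/-- The sum of `J` blocks of length `l` whose starting points `r, r + p, r + 2p, …` are
equally spaced. -/
noncomputable def blocksSum (m : ℕ → ℕ) (p r l J : ℕ) (x : ℝ) : ℝ :=
  ∑ j ∈ Finset.range J, blockSum m (j * p + r) l x

theorem continuous_blocksSum (m : ℕ → ℕ) (p r l J : ℕ) : Continuous (blocksSum m p r l J) := by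
  unfold blocksSum
  exact continuous_finsetSum _ fun _ _ => continuous_blockSum _ _ _

theorem blockSum_mul_eq (m : ℕ → ℕ) (L G J : ℕ) (x : ℝ) :
    blockSum m 0 (J * (L + G)) x
      = blocksSum m (L + G) 0 L J x + blocksSum m (L + G) L G J x := by
  induction J with
  | zero => simp [blockSum, blocksSum]
  | succ J ih =>
    rw [add_mul, one_mul, blockSum_add, ih, blockSum_add]
    simp only [blocksSum, Finset.sum_range_succ, zero_add, add_zero]
    ring

theorem Continuous.integrable_exp_mul {f : ℝ → ℝ} (hf : Continuous f) (t : ℝ) :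
    Integrable (fun x => Real.exp (t * f x)) unitIntervalMeasure :=
  Continuous.integrable_unitIntervalMeasure (by fun_prop)

section

variable {m : ℕ → ℕ} {p r l J : ℕ} {t : ℝ}

theorem abs_mul_blockSum_le (ht : |t| * (2 * l) ≤ 1) (a : ℕ) (x : ℝ) :
    |t * blockSum m a l x| ≤ 1 ∧ |t * blockSum m a l x| ^ 3 ≤ 8 * |t| ^ 3 * l ^ 3 := by
  have h : |t * blockSum m a l x| ≤ |t| * (2 * l) := by
    rw [abs_mul]
    gcongr
    exact abs_blockSum_le m a l x
  refine ⟨h.trans ht, ?_⟩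
  calc |t * blockSum m a l x| ^ 3 ≤ (|t| * (2 * l)) ^ 3 := by gcongr
    _ = _ := by ring

/-- The constant is `24 = 3 * 2 ^ 3`: the cubic Taylor bound combined with `|blockSum| ≤ 2 * l`. -/
theorem cgf_blocksSum_le (hprod : ∫ x, ∏ j ∈ Finset.range J, (1 + t * blockSum m (j * p + r) l x
      + t ^ 2 * blockSum m (j * p + r) l x ^ 2 / 2) ∂unitIntervalMeasure
      = (1 + t ^ 2 * l / 2) ^ J) (ht : |t| * (2 * l) ≤ 1) :
    cgf (blocksSum m p r l J) unitIntervalMeasure t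
      ≤ J * (t ^ 2 * l / 2 + 24 * |t| ^ 3 * l ^ 3) := by
  have hcont : Continuous fun x => ∏ j ∈ Finset.range J, (1 + t * blockSum m (j * p + r) l x
      + t ^ 2 * blockSum m (j * p + r) l x ^ 2 / 2) :=
    continuous_finsetProd _ fun j _ => by
      have := continuous_blockSum m (j * p + r) l
      fun_prop
  have hint := (continuous_blocksSum m p r l J).integrable_exp_mul t
  have key : mgf (blocksSum m p r l J) unitIntervalMeasure t ≤
      ∫ x, Real.exp (24 * |t| ^ 3 * l ^ 3) ^ J
        * ∏ j ∈ Finset.range J, (1 + t * blockSum m (j * p + r) l x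
      + t ^ 2 * blockSum m (j * p + r) l x ^ 2 / 2) ∂unitIntervalMeasure := by
    refine integral_mono hint (hcont.integrable_unitIntervalMeasure.const_mul _) fun x => ?_
    simp only [blocksSum]
    rw [Finset.mul_sum, Real.exp_sum, ← Finset.card_range J, ← Finset.prod_const,
      Finset.card_range, ← Finset.prod_mul_distrib]
    refine Finset.prod_le_prod (fun _ _ => (Real.exp_pos _).le) fun j _ => ?_
    obtain ⟨h1, h2⟩ := abs_mul_blockSum_le (m := m) ht (j * p + r) x
    refine (exp_le_quadratic_mul_exp h1).trans ?_
    rw [mul_comm, mul_pow]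
    have h3 := Real.exp_le_exp.2 (show 3 * |t * blockSum m (j * p + r) l x| ^ 3
      ≤ 24 * |t| ^ 3 * l ^ 3 by linarith)
    have : 0 ≤ 1 + t * blockSum m (j * p + r) l x + t ^ 2 * blockSum m (j * p + r) l x ^ 2 / 2 := by
      nlinarith [sq_nonneg (t * blockSum m (j * p + r) l x + 1)]
    exact mul_le_mul_of_nonneg_right h3 this
  rw [integral_const_mul, hprod, ← mul_pow] at key
  have h2 := Real.log_le_log (mgf_pos hint) key
  rw [Real.log_pow, Real.log_mul (Real.exp_pos _).ne' (by positivity), Real.log_exp] at h2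
  refine h2.trans ?_
  refine mul_le_mul_of_nonneg_left ?_ (Nat.cast_nonneg _)
  have := Real.log_le_sub_one_of_pos (show 0 < 1 + t ^ 2 * l / 2 by positivity)
  linarith

theorem le_cgf_blocksSum (hprod : ∫ x, ∏ j ∈ Finset.range J, (1 + t * blockSum m (j * p + r) l x
      + t ^ 2 * blockSum m (j * p + r) l x ^ 2 / 2) ∂unitIntervalMeasure
      = (1 + t ^ 2 * l / 2) ^ J) (ht : |t| * (2 * l) ≤ 1) :
    J * (t ^ 2 * l / 2 - (t ^ 2 * l / 2) ^ 2 / 2 - 24 * |t| ^ 3 * l ^ 3)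
      ≤ cgf (blocksSum m p r l J) unitIntervalMeasure t := by
  have hcont : Continuous fun x => ∏ j ∈ Finset.range J, (1 + t * blockSum m (j * p + r) l x
      + t ^ 2 * blockSum m (j * p + r) l x ^ 2 / 2) :=
    continuous_finsetProd _ fun j _ => by
      have := continuous_blockSum m (j * p + r) l
      fun_prop
  have hint := (continuous_blocksSum m p r l J).integrable_exp_mul t
  have key : ∫ x, ∏ j ∈ Finset.range J, (1 + t * blockSum m (j * p + r) l x
      + t ^ 2 * blockSum m (j * p + r) l x ^ 2 / 2) ∂unitIntervalMeasure ≤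
      ∫ x, Real.exp (24 * |t| ^ 3 * l ^ 3) ^ J
        * Real.exp (t * blocksSum m p r l J x) ∂unitIntervalMeasure := by
    refine integral_mono hcont.integrable_unitIntervalMeasure (hint.const_mul _) fun x => ?_
    simp only [blocksSum]
    rw [Finset.mul_sum, Real.exp_sum, ← Finset.card_range J, ← Finset.prod_const,
      Finset.card_range, ← Finset.prod_mul_distrib]
    refine Finset.prod_le_prod (fun j _ => ?_) fun j _ => ?_
    · nlinarith [sq_nonneg (t * blockSum m (j * p + r) l x + 1)]
    obtain ⟨h1, h2⟩ := abs_mul_blockSum_le (m := m) ht (j * p + r) x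
    rw [← mul_pow]
    refine (quadratic_le_exp_mul_exp h1).trans ?_
    rw [mul_comm]
    exact mul_le_mul_of_nonneg_right (Real.exp_le_exp.2 (by linarith)) (Real.exp_pos _).le
  rw [integral_const_mul, hprod,
    show ∫ x, Real.exp (t * blocksSum m p r l J x) ∂unitIntervalMeasure
      = Real.exp (cgf (blocksSum m p r l J) unitIntervalMeasure t) from (exp_cgf hint).symm] at key
  have u0 : 0 ≤ t ^ 2 * l / 2 := by positivity
  have h2 := Real.log_le_log (by positivity) key
  rw [Real.log_pow, Real.log_mul (by positivity) (Real.exp_pos _).ne', Real.log_exp,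
    Real.log_pow, Real.log_exp] at h2
  have h3 : t ^ 2 * l / 2 - (t ^ 2 * l / 2) ^ 2 / 2 ≤ Real.log (1 + t ^ 2 * l / 2) := by
    refine le_trans ?_ (Real.le_log_one_add_of_nonneg u0)
    rw [le_div_iff₀ (by positivity)]
    nlinarith [pow_nonneg u0 3]
  have h4 := mul_le_mul_of_nonneg_left h3 (Nat.cast_nonneg (α := ℝ) J)
  linarith

end

end BlockCgf

/-! ### Passage to the limit and removal of the short blocks. -/

section Limits

variable {s τ : ℕ → ℝ}

theorem tendsto_block_upper {J : ℕ → ℕ} {c : ℝ} (hτ : Tendsto τ atTop (𝓝 0))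
    (hJ : Tendsto (fun N => s N * τ N ^ 2 * J N) atTop (𝓝 c)) (θ : ℝ) (l : ℕ) :
    Tendsto (fun N => s N * (J N * ((θ * τ N) ^ 2 * l / 2 + 24 * |θ * τ N| ^ 3 * l ^ 3))) atTop
      (𝓝 (c * (θ ^ 2 * l / 2))) := by
  have h := hJ.mul ((tendsto_const_nhds (x := θ ^ 2 * l / 2)).add
    (hτ.abs.const_mul (24 * |θ| ^ 3 * l ^ 3)))
  rw [abs_zero, mul_zero, add_zero] at h
  refine h.congr fun N => ?_
  rw [abs_mul, mul_pow |θ|, pow_succ |τ N|, sq_abs]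
  ring

theorem tendsto_block_lower {J : ℕ → ℕ} {c : ℝ} (hτ : Tendsto τ atTop (𝓝 0))
    (hJ : Tendsto (fun N => s N * τ N ^ 2 * J N) atTop (𝓝 c)) (θ : ℝ) (l : ℕ) :
    Tendsto (fun N => s N * (J N * ((θ * τ N) ^ 2 * l / 2 - ((θ * τ N) ^ 2 * l / 2) ^ 2 / 2
      - 24 * |θ * τ N| ^ 3 * l ^ 3))) atTop (𝓝 (c * (θ ^ 2 * l / 2))) := by
  have h := hJ.mul (((tendsto_const_nhds (x := θ ^ 2 * l / 2)).sub
    ((hτ.pow 2).const_mul (θ ^ 4 * l ^ 2 / 8))).sub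
    (hτ.abs.const_mul (24 * |θ| ^ 3 * l ^ 3)))
  rw [abs_zero, mul_zero, sub_zero, zero_pow two_ne_zero, mul_zero, sub_zero] at h
  refine h.congr fun N => ?_
  rw [abs_mul, mul_pow |θ|, pow_succ |τ N|, sq_abs]
  ring

theorem tendsto_mul_natDiv (hs : ∀ᶠ N : ℕ in atTop, s N * τ N ^ 2 * N = 1) {p : ℕ} (hp : 0 < p) :
    Tendsto (fun N : ℕ => s N * τ N ^ 2 * (N / p : ℕ)) atTop (𝓝 (1 / p)) := by
  have h := (tendsto_nat_floor_mul_div_atTop (R := ℝ) (a := 1 / p) (by positivity)).comp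
    tendsto_natCast_atTop_atTop
  refine h.congr' ?_
  filter_upwards [hs, eventually_gt_atTop 0] with N h1 h2
  have h3 : s N * τ N ^ 2 = 1 / N := by
    rw [eq_div_iff (by positivity)]
    exact h1
  simp only [Function.comp_apply]
  rw [h3, one_div_mul_eq_div, Nat.floor_div_eq_div, div_eq_inv_mul]
  ring

/-- First `α` is taken close to 1, then `L` large depending on `α`, so that the short-block share
beats the factor `1 / β`. -/
theorem exists_split_parameters (G : ℕ) (θ : ℝ) {η : ℝ} (hη : 0 < η) :
    ∃ (α β : ℝ) (L : ℕ), 0 < α ∧ 0 < β ∧ α + β = 1 ∧ 0 < L ∧ G ≤ L ∧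
      θ ^ 2 / 2 * (L / (L + G : ℝ)) / α + θ ^ 2 / 2 * (G / (L + G : ℝ)) / β < θ ^ 2 / 2 + η ∧
      θ ^ 2 / 2 - η < θ ^ 2 / 2 * (L / (L + G : ℝ)) * α
        - θ ^ 2 / 2 * (G / (L + G : ℝ)) * (α / β) := by
  obtain ⟨α, ⟨hα1, hα2⟩, hα⟩ : ∃ α : ℝ, (θ ^ 2 / 2 / α < θ ^ 2 / 2 + η ∧
      θ ^ 2 / 2 - η < θ ^ 2 / 2 * α) ∧ α ∈ Set.Ioo (0 : ℝ) 1 := by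
    have t1 : Tendsto (fun α : ℝ => θ ^ 2 / 2 / α) (𝓝[<] 1) (𝓝 (θ ^ 2 / 2 / 1)) :=
      (tendsto_const_nhds.div tendsto_id one_ne_zero).mono_left nhdsWithin_le_nhds
    have t2 : Tendsto (fun α : ℝ => θ ^ 2 / 2 * α) (𝓝[<] 1) (𝓝 (θ ^ 2 / 2 * 1)) :=
      (tendsto_const_nhds.mul tendsto_id).mono_left nhdsWithin_le_nhds
    exact (((t1.eventually_lt_const (by linarith)).and
      (t2.eventually_const_lt (by linarith))).and (Ioo_mem_nhdsLT one_pos)).exists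
  have hG : Tendsto (fun L : ℕ => (G / (L + G : ℝ))) atTop (𝓝 0) :=
    tendsto_const_nhds.div_atTop
      (tendsto_atTop_add_const_right _ _ tendsto_natCast_atTop_atTop)
  have hL : Tendsto (fun L : ℕ => (L / (L + G : ℝ))) atTop (𝓝 1) := by
    have := hG.const_sub 1
    rw [sub_zero] at this
    refine this.congr' ?_
    filter_upwards [eventually_gt_atTop 0] with L h
    have : (0 : ℝ) < L + G := by positivity
    field_simp
    ring
  have u1 := ((hL.const_mul (θ ^ 2 / 2)).div_const α).add
    ((hG.const_mul (θ ^ 2 / 2)).div_const (1 - α))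
  have u2 := ((hL.const_mul (θ ^ 2 / 2)).mul_const α).sub
    ((hG.const_mul (θ ^ 2 / 2)).mul_const (α / (1 - α)))
  obtain ⟨L, h1, h2, h3, h4⟩ := ((u1.eventually_lt_const (u := θ ^ 2 / 2 + η) (by simpa using hα1)).and
    ((u2.eventually_const_lt (u := θ ^ 2 / 2 - η) (by simpa using hα2)).and
    ((eventually_gt_atTop 0).and (eventually_ge_atTop G)))).exists
  exact ⟨α, 1 - α, L, hα.1, by linarith [hα.2], by ring, h3, h4, h1, h2⟩

theorem abs_blockSum_sub_blocks_le (m : ℕ → ℕ) (L G N : ℕ) (hp : 0 < L + G) (x : ℝ) :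
    |(blockSum m 0 N x - blocksSum m (L + G) 0 L (N / (L + G)) x)
      - blocksSum m (L + G) L G (N / (L + G)) x| ≤ 2 * (L + G : ℕ) := by
  have h := blockSum_mul_eq m L G (N / (L + G)) x
  have h2 := blockSum_add m 0 (N / (L + G) * (L + G)) (N % (L + G)) x
  rw [Nat.div_add_mod'] at h2
  rw [h2, h, show ∀ a b c : ℝ, a + b + c - a - b = c from fun a b c => by ring]
  refine (abs_blockSum_le _ _ _ _).trans ?_
  gcongr
  exact (Nat.mod_lt _ hp).le

/-- The cumulant generating functions of lacunary cosine sums are asymptotically Gaussian in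
the moderate deviation regime. -/
theorem IsLacunary.tendsto_cgf_blockSum {m : ℕ → ℕ} {q : ℝ} (hm : IsLacunary m q)
    (hs0 : Tendsto s atTop (𝓝 0)) (hspos : ∀ N, 0 ≤ s N)
    (hτ : Tendsto τ atTop (𝓝 0)) (hs : ∀ᶠ N : ℕ in atTop, s N * τ N ^ 2 * N = 1) (θ : ℝ) :
    Tendsto (fun N => s N * cgf (blockSum m 0 N) unitIntervalMeasure (θ * τ N)) atTop
      (𝓝 (θ ^ 2 / 2)) := by
  obtain ⟨G, hG⟩ := hm.exists_gap_forall_integral_prod_eq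
  refine Metric.tendsto_nhds.2 fun η hη => ?_
  obtain ⟨α, β, L, hα, hβ, hαβ, hL, hGL, hup, hlow⟩ := exists_split_parameters G θ hη
  set p := L + G with hp
  have hp0 : 0 < p := by omega
  have hpc : (p : ℝ) = L + G := by rw [hp]; push_cast; ring
  rw [← hpc] at hup hlow
  have hp0' : (0 : ℝ) < p := Nat.cast_pos.2 hp0
  have hJ := tendsto_mul_natDiv hs hp0
  have hτl : ∀ (θ : ℝ) (l : ℕ), ∀ᶠ N in atTop, |θ * τ N| * (2 * l) ≤ 1 := fun θ l => by
    have := ((hτ.const_mul θ).abs.mul_const (2 * l : ℝ))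
    rw [mul_zero, abs_zero, zero_mul] at this
    exact this.eventually_le_const one_pos
  have hR : ∀ θ : ℝ, Tendsto (fun N => s N * (|θ * τ N| * (2 * p))) atTop (𝓝 0) := fun θ => by
    have := hs0.mul ((hτ.const_mul θ).abs.mul_const (2 * p : ℝ))
    rwa [zero_mul] at this
  set A : ℕ → ℝ → ℝ := fun N => blocksSum m p 0 L (N / p) with hA
  have hAc : ∀ N, Continuous (A N) := fun N => continuous_blocksSum _ _ _ _ _
  have hSc : ∀ N, Continuous (blockSum m 0 N) := fun N => continuous_blockSum _ _ _
  have hDle : ∀ N t, cgf (blockSum m 0 N - A N) unitIntervalMeasure t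
      ≤ |t| * (2 * p) + cgf (blocksSum m p L G (N / p)) unitIntervalMeasure t := fun N t =>
    cgf_le_of_abs_sub_le (abs_blockSum_sub_blocks_le m L G N hp0)
      (((hSc N).sub (hAc N)).integrable_exp_mul t)
      ((continuous_blocksSum _ _ _ _ _).integrable_exp_mul t)
  -- `hU` and `hV` are the limits of the two Hölder bounds `h1` and `h2` below, after inserting the
  -- block estimates.
  have hU := (((tendsto_block_upper hτ hJ (θ / α) L).const_mul α).add
    (((hR (θ / β)).add (tendsto_block_upper hτ hJ (θ / β) G)).const_mul β))
  have hV := ((tendsto_block_lower hτ hJ (α * θ) L).sub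
    (((hR (-(α * θ / β))).add
      (tendsto_block_upper hτ hJ (-(α * θ / β)) G)).const_mul β)).const_mul α⁻¹
  have hU' := hU.eventually_lt_const (u := θ ^ 2 / 2 + η) (by
    refine lt_of_eq_of_lt ?_ hup
    field_simp
    ring)
  have hV' := hV.eventually_const_lt (u := θ ^ 2 / 2 - η) (by
    refine lt_of_lt_of_eq hlow ?_
    field_simp
    ring)
  filter_upwards [hU', hV', hτl (θ / α) L, hτl (θ / β) G, hτl (α * θ) L,
    hτl (-(α * θ / β)) G] with N hUN hVN t1 t2 t3 t4
  have b1 := cgf_blocksSum_le (hG p 0 L le_rfl (θ / α * τ N) (N / p)) t1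
  -- The short blocks are in turn separated by the long ones; this needs `G + G ≤ p`, hence `G ≤ L`.
  have b2 := cgf_blocksSum_le (hG p L G (by omega) (θ / β * τ N) (N / p)) t2
  have b3 := le_cgf_blocksSum (hG p 0 L le_rfl (α * θ * τ N) (N / p)) t3
  have b4 := cgf_blocksSum_le (hG p L G (by omega) (-(α * θ / β) * τ N) (N / p)) t4
  have d2 := hDle N (θ / β * τ N)
  have d4 := hDle N (-(α * θ / β) * τ N)
  have h1 : cgf (blockSum m 0 N) unitIntervalMeasure (θ * τ N)
      ≤ α * cgf (A N) unitIntervalMeasure (θ / α * τ N)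
        + β * cgf (blockSum m 0 N - A N) unitIntervalMeasure (θ / β * τ N) := by
    have := cgf_add_le (t := θ * τ N) (X := A N) (Y := blockSum m 0 N - A N) hα hβ hαβ
      ((hAc N).integrable_exp_mul _) (((hSc N).sub (hAc N)).integrable_exp_mul _)
      (((hAc N).add ((hSc N).sub (hAc N))).integrable_exp_mul _)
    rwa [add_sub_cancel, mul_div_right_comm, mul_div_right_comm] at this
  -- Hölder reversed: the long blocks are the full sum minus the rest, so their lower bound passes
  -- to the full sum.
  have h2 : cgf (A N) unitIntervalMeasure (α * θ * τ N)
      ≤ α * cgf (blockSum m 0 N) unitIntervalMeasure (θ * τ N)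
        + β * cgf (blockSum m 0 N - A N) unitIntervalMeasure (-(α * θ / β) * τ N) := by
    have := cgf_add_le (t := α * θ * τ N) (X := blockSum m 0 N) (Y := -(blockSum m 0 N - A N))
      hα hβ hαβ ((hSc N).integrable_exp_mul _) (((hSc N).sub (hAc N)).neg.integrable_exp_mul _)
      (((hSc N).add ((hSc N).sub (hAc N)).neg).integrable_exp_mul _)
    rw [cgf_neg, show blockSum m 0 N + -(blockSum m 0 N - A N) = A N by abel] at this
    convert this using 3
    · congr 1
      field_simp
    · congr 1
      ring
  rw [Real.dist_eq, abs_lt]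
  have sN := hspos N
  constructor
  · suffices θ ^ 2 / 2 - η < s N * cgf (blockSum m 0 N) unitIntervalMeasure (θ * τ N) by linarith
    refine hVN.trans_le ?_
    rw [inv_mul_le_iff₀ hα, ← mul_add, mul_left_comm β, ← mul_sub, mul_left_comm α]
    refine mul_le_mul_of_nonneg_left ?_ sN
    have := mul_le_mul_of_nonneg_left (d4.trans (add_le_add_right b4 _)) hβ.le
    linarith
  · suffices s N * cgf (blockSum m 0 N) unitIntervalMeasure (θ * τ N) < θ ^ 2 / 2 + η by linarith
    refine lt_of_le_of_lt ?_ hUN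
    rw [← mul_add, mul_left_comm β, mul_left_comm α, ← mul_add]
    refine mul_le_mul_of_nonneg_left ?_ sN
    have e1 := mul_le_mul_of_nonneg_left (d2.trans (add_le_add_right b2 _)) hβ.le
    have e2 := mul_le_mul_of_nonneg_left b1 hα.le
    linarith

end Limits

/-! ### Reindexing from 0 and conclusion. -/

theorem HadamardGap.isLacunary {n : ℕ → ℕ} {q : ℝ} (hn : HadamardGap n q) :
    IsLacunary (fun k => n (k + 1)) q where
  one_lt := hn.1
  pos k := hn.2.1 _ (Nat.succ_pos k)
  mul_le k := by
    have h := hn.2.2 (k + 1) (Nat.succ_pos k)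
    rwa [le_div_iff₀ (Nat.cast_pos.2 (hn.2.1 _ (Nat.succ_pos k)))] at h

theorem lacunarySum_eq_mul_blockSum (n : ℕ → ℕ) (lam : ℕ → ℝ) (N : ℕ) (x : ℝ) :
    lacunarySum n lam N x = lam N / √(N : ℝ) * blockSum (fun k => n (k + 1)) 0 N x := by
  rw [lacunarySum, blockSum, ← Finset.Ico_add_one_right_eq_Icc, Finset.sum_Ico_eq_sum_range]
  simp [add_comm]

theorem corollary2 (n : ℕ → ℕ) (q : ℝ) (hn : HadamardGap n q)
    (lam : ℕ → ℝ) (hpos : ∀ N : ℕ, 1 ≤ N → 0 < lam N)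
    (hnull : Tendsto lam atTop (𝓝 0))
    (hgrow : Tendsto (fun N : ℕ => √(N : ℝ) * lam N) atTop atTop) :
    SatisfiesMDP unitIntervalMeasure (lacunarySum n lam) lam 1 := by
  have hcont : ∀ N, Continuous (lacunarySum n lam N) := fun N => by
    unfold lacunarySum
    fun_prop
  have hlam : ∀ᶠ N in atTop, 0 < lam N := by
    filter_upwards [eventually_ge_atTop 1] with N h using hpos N h
  refine satisfiesMDP_one_of_tendsto_cgf (fun N => (hcont N).measurable) hlam hnull
    (fun N t => (hcont N).integrable_exp_mul t) fun θ => ?_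
  have hs0 : Tendsto (fun N => lam N ^ 2) atTop (𝓝 0) := by simpa using hnull.pow 2
  -- Here `s = lam ^ 2` and `τ = 1 / (√N * lam)`, since `(lam / √N) * (θ / lam ^ 2) = θ * τ`. The
  -- identity `s * τ ^ 2 * N = 1` fails at `N = 0`, so it is only asked eventually.
  refine (hn.isLacunary.tendsto_cgf_blockSum hs0 (fun N => sq_nonneg _)
    hgrow.inv_tendsto_atTop ?_ θ).congr' ?_
  · filter_upwards [eventually_ge_atTop 1] with N h
    have h1 := hpos N h
    have h2 : (0 : ℝ) < N := Nat.cast_pos.2 h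
    simp only [Pi.inv_apply]
    rw [inv_pow, mul_pow, Real.sq_sqrt h2.le]
    field_simp
  · filter_upwards [eventually_ge_atTop 1] with N h
    have h1 := hpos N h
    have h2 : (0 : ℝ) < √(N : ℝ) := Real.sqrt_pos.2 (Nat.cast_pos.2 h)
    have h3 : lacunarySum n lam N
        = fun x => lam N / √(N : ℝ) * blockSum (fun k => n (k + 1)) 0 N x :=
      funext (lacunarySum_eq_mul_blockSum n lam N)
    rw [h3, cgf, cgf, mgf_const_mul]
    simp only [Pi.inv_apply]
    congr 3
    field_simp
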